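/- Let $\mathcal X$ be a measurable space of outcomes (for instance $\mathbb R$ or an interval), let $P^a,P^b$ be probability measures on $\mathcal X$, and let $\mathcal F$ be a class of measurable (utility) functions $f:\mathcal X\to\mathbb R$. For a measure $Q$ write $Qf=\int f\,dQ$. Let $\ell^\infty(\mathcal F)$ be the space of bounded functions $\mathcal F\to\mathbb R$ with the supremum norm, and let weak convergence in $\ell^\infty(\mathcal F)$ be meant in the Hoffmann-Jørgensen sense: maps $Z_k$ converge weakly to a Borel measurable random element $Z$ if $E^*h(Z_k)\to E\,h(Z)$ for every bounded continuous $h:\ell^\infty(\mathcal F)\to\mathbb R$, where $E^*$ is outer expectation. The class $\mathcal F$ is called $P$-Donsker if its members are measurable and square integrable under $P$, $\sup_{f\in\mathcal F}|f(x)-Pf|<\infty$ for every $x$, and, for the coordinate projections $X_1,X_2,\dots$ of the product space $(\mathcal X^{\mathbb N},P^{\otimes\mathbb N})$, the empirical process $\sqrt n\,\bigl(n^{-1}\sum_{i\le n}f(X_i)-Pf\bigr)$, $f\in\mathcal F$, converges weakly in $\ell^\infty(\mathcal F)$ to a tight Borel measurable limit. Assume that $\mathcal F$ is both $P^a$-Donsker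 and $P^b$-Donsker. On a probability space, let $Y^a_1,Y^a_2,\dots$ be iid with distribution $P^a$ and let $Y^b_1,Y^b_2,\dots$ be iid with distribution $P^b$, the two sequences being independent of each other. Let $n_a,n_b\to\infty$ with $$\sqrt{n_a/n_b}\to\lambda\in[0,\infty),$$ and put $\mathbb P_{n_a}f=n_a^{-1}\sum_{i=1}^{n_a}f(Y^a_i)$ and $\mathbb P_{n_b}f=n_b^{-1}\sum_{i=1}^{n_b}f(Y^b_i)$. Then the expected-utility-difference process $$\mathbb G^{\Delta}_{n}f=\sqrt{n_a}\,\bigl[(\mathbb P_{n_a}-\mathbb P_{n_b})f-(P^a-P^b)f\bigr],\qquad f\in\mathcal F,$$ takes values in $\ell^\infty(\mathcal F)$ for all large $n_a,n_b$ and converges weakly in $\ell^\infty(\mathcal F)$ to $\mathbb G^{\Delta}=\mathbb G^a-\lambda\,\mathbb G^b$. Here $\mathbb G^a$ and $\mathbb G^b$ are independent, tight, Borel measurable, mean-zero Gaussian processes in $\ell^\infty(\mathcal F)$ with covariances $P^a(fg)-P^af\,P^ag$ and $P^b(fg)-P^bf\,P^bg$ (the $P^a$- and $P^b$-Brownian bridges),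 and $\mathbb G^{\Delta}$ is a tight, Borel measurable, mean-zero Gaussian process with covariance $$E[\mathbb G^{\Delta}f\;\mathbb G^{\Delta}g]=P^a(fg)-P^af\,P^ag+\lambda^2\bigl[P^b(fg)-P^bf\,P^bg\bigr],\qquad f,g\in\mathcal F.$$ -/

import Mathlib

open MeasureTheory ProbabilityTheory Filter Topology
open scoped ENNReal BoundedContinuousFunction

universe u v

/-- `ℓ^∞(F)`: the bounded real functions on the class `F`, with the supremum norm. -/
abbrev EllInf {X : Type u} (F : Set (X → ℝ)) : Type u := lp (fun _ : F => ℝ) ∞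

/-- `ℓ^∞(F)` carries the Borel σ-algebra of the supremum norm. -/
noncomputable instance EllInf.instMeasurableSpace {X : Type u} (F : Set (X → ℝ)) :
    MeasurableSpace (EllInf F) := borel (EllInf F)

instance EllInf.instBorelSpace {X : Type u} (F : Set (X → ℝ)) : BorelSpace (EllInf F) := ⟨rfl⟩

open Classical in
/-- A bounded function on `F`, viewed as an element of `ℓ^∞(F)`
(unbounded functions are sent to `0`). -/
noncomputable def toEllInf {X : Type u} {F : Set (X → ℝ)} (z : F → ℝ) : EllInf F :=
  if h : Memℓp z ∞ then ⟨z, h⟩ else 0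

/-- Outer expectation `E^* T` of a bounded, possibly non-measurable, function `T`:
the infimum of `E U` over the measurable integrable `U ≥ T`. -/
noncomputable def outerExpectation {Ω : Type*} [MeasurableSpace Ω] (μ : Measure Ω)
    (T : Ω → ℝ) : ℝ :=
  sInf {r : ℝ | ∃ U : Ω → ℝ, Measurable U ∧ Integrable U μ ∧ (∀ ω, T ω ≤ U ω) ∧
    r = ∫ ω, U ω ∂μ}

/-- Weak convergence, in the sense of Hoffmann-Jørgensen, of arbitrary (possibly non-measurable)
maps `Z k : Ω → E` to a Borel law `ν` on `E`: `E^* h(Z k) → ∫ h dν` for all bounded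
continuous `h`. -/
def WeaklyConvergesTo {Ω E : Type*} [MeasurableSpace Ω] [TopologicalSpace E] [MeasurableSpace E]
    (μ : Measure Ω) (Z : ℕ → Ω → E) (ν : Measure E) : Prop :=
  ∀ h : E →ᵇ ℝ, Tendsto (fun k => outerExpectation μ (fun ω => h (Z k ω))) atTop
    (𝓝 (∫ z, h z ∂ν))

/-- The sample mean `ℙₙ f = n⁻¹ ∑_{i < n} f (x i)`. -/
noncomputable def sampleMean {X : Type u} (x : ℕ → X) (n : ℕ) (f : X → ℝ) : ℝ :=
  (n : ℝ)⁻¹ * ∑ i ∈ Finset.range n, f (x i)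

/-- The empirical process `𝔾ₙ f = √n (ℙₙ f - P f)`, `f ∈ F`, of the sample
`x 0, …, x (n - 1)`. -/
noncomputable def empiricalProcess {X : Type u} [MeasurableSpace X] (P : Measure X)
    (F : Set (X → ℝ)) (n : ℕ) (x : ℕ → X) (f : F) : ℝ :=
  √(n : ℝ) * (sampleMean x n f - ∫ t, (f : X → ℝ) t ∂P)

/-- The difference process `√m [(ℙ^a_m f - ℙ^b_n f) - (P^a f - P^b f)]`, `f ∈ F`, of the samples
`x 0, …, x (m - 1)` and `y 0, …, y (n - 1)`. -/
noncomputable def differenceProcess {X : Type u} [MeasurableSpace X] (Pa Pb : Measure X)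
    (F : Set (X → ℝ)) (m n : ℕ) (x y : ℕ → X) (f : F) : ℝ :=
  √(m : ℝ) * ((sampleMean x m f - sampleMean y n f)
    - (∫ t, (f : X → ℝ) t ∂Pa - ∫ t, (f : X → ℝ) t ∂Pb))

/-- `F` is `P`-Donsker: it consists of measurable, square-integrable functions,
`sup_{f ∈ F} |f x - P f| < ∞` for every `x` (so that the empirical process takes values
in `ℓ^∞(F)`), and the empirical process of an i.i.d. sample from `P` (the coordinates of the
infinite product space) converges weakly in `ℓ^∞(F)` to a tight Borel limit. -/
structure IsDonsker {X : Type u} [MeasurableSpace X] (P : Measure X) [IsProbabilityMeasure P]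
    (F : Set (X → ℝ)) : Prop where
  measurable : ∀ f ∈ F, Measurable f
  memLp : ∀ f ∈ F, MemLp f 2 P
  bounded : ∀ x : X, ∃ C : ℝ, ∀ f ∈ F, |f x - ∫ t, f t ∂P| ≤ C
  exists_limit : ∃ ν : Measure (EllInf F), IsProbabilityMeasure ν ∧ IsTightMeasureSet {ν} ∧
    WeaklyConvergesTo (Measure.infinitePi (fun _ : ℕ => P))
      (fun n x => toEllInf (empiricalProcess P F n x)) ν

/-- `G` is a tight Borel measurable random element of `ℓ^∞(F)` that is a mean-zero Gaussian process
indexed by `F` with covariance function `K`. -/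
structure IsTightCenteredGaussian {X : Type u} {F : Set (X → ℝ)} {Ω : Type*} [MeasurableSpace Ω]
    (μ : Measure Ω) (G : Ω → EllInf F) (K : F → F → ℝ) : Prop where
  measurable : Measurable G
  tight : IsTightMeasureSet {μ.map G}
  gaussian : IsGaussianProcess (fun (f : F) ω => G ω f) μ
  mean_zero : ∀ f : F, ∫ ω, G ω f ∂μ = 0
  covariance : ∀ f g : F, ∫ ω, G ω f * G ω g ∂μ = K f g

/-- The `P`-Brownian bridge covariance `P (f g) - P f P g`. -/
noncomputable def bridgeCov {X : Type u} [MeasurableSpace X] (P : Measure X) {F : Set (X → ℝ)}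
    (f g : F) : ℝ :=
  ∫ t, (f : X → ℝ) t * (g : X → ℝ) t ∂P
    - (∫ t, (f : X → ℝ) t ∂P) * ∫ t, (g : X → ℝ) t ∂P

/-! The difference process equals `𝔾ᵃ - √(m/n) • 𝔾ᵇ`, a combination of two independent empirical
processes (`differenceProcess_eq`). The difficulty is that these are non-measurable maps into a
non-separable space, so weak convergence of the pair cannot be taken from product measures.

`WeaklyConvergesTo.sub_smul_of_indepFun` avoids this. Tight limits live, up to small mass, on
compact sets, where partitions of unity replace `h (x - l • y)` by a finite sum of products `φ i x *
ψ j y`. Each factor has a measurable majorant depending on one sample only, and independence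
factorises the integral of a product of majorants. This bounds the outer expectation from above; the
same bound for `-h` gives the lower one.

The limits are identified by testing finite linear combinations of coordinates: the classical
central limit theorem gives their law (`IsDonsker.map_sum_mul_eq_gaussianReal`), and polarisation
gives the covariance. Tightness also supplies independent copies whose difference is Borel
(`exists_indepFun_of_isTightMeasureSet`). -/

section OuterExpectation

/-! ### Outer expectation -/

variable {Ω : Type*} [MeasurableSpace Ω] {μ : Measure Ω}

/-- The lower bound `c` keeps the set of majorant integrals bounded below, so that `sInf` is a true
infimum. -/
lemma outerExpectation_le [IsProbabilityMeasure μ] {T U : Ω → ℝ} {c : ℝ} (hT : ∀ ω, c ≤ T ω)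
    (hU : Measurable U) (hUi : Integrable U μ) (hTU : ∀ ω, T ω ≤ U ω) :
    outerExpectation μ T ≤ ∫ ω, U ω ∂μ := by
  refine csInf_le ⟨c, ?_⟩ ⟨U, hU, hUi, hTU, rfl⟩
  rintro r ⟨V, -, hVi, hTV, rfl⟩
  simpa using integral_mono (integrable_const c) hVi fun ω => (hT ω).trans (hTV ω)

lemma exists_majorant_of_outerExpectation_lt [IsFiniteMeasure μ] {T : Ω → ℝ} {C r : ℝ}
    (hT : ∀ ω, T ω ≤ C) (hr : outerExpectation μ T < r) :
    ∃ U : Ω → ℝ, Measurable U ∧ Integrable U μ ∧ (∀ ω, T ω ≤ U ω) ∧ ∫ ω, U ω ∂μ < r := by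
  obtain ⟨_, ⟨U, hU, hUi, hTU, rfl⟩, h⟩ := exists_lt_of_csInf_lt
    (by exact ⟨_, fun _ => C, measurable_const, integrable_const C, hT, rfl⟩) hr
  exact ⟨U, hU, hUi, hTU, h⟩

lemma outerExpectation_eq_integral [IsProbabilityMeasure μ] {T : Ω → ℝ} {C : ℝ}
    (hT : Measurable T) (hC : ∀ ω, |T ω| ≤ C) : outerExpectation μ T = ∫ ω, T ω ∂μ := by
  have hTi : Integrable T μ :=
    .of_bound hT.aestronglyMeasurable C (.of_forall hC)
  refine le_antisymm
    (outerExpectation_le (fun ω => (abs_le.1 (hC ω)).1) hT hTi fun _ => le_rfl) ?_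
  refine le_csInf ⟨_, T, hT, hTi, fun _ => le_rfl, rfl⟩ ?_
  rintro r ⟨V, -, hVi, hTV, rfl⟩
  exact integral_mono hTi hVi hTV

/-- Majorants of `T` and of `-T` have a nonnegative sum. This turns upper bounds for `-h` into lower
bounds for `h`. -/
lemma neg_outerExpectation_neg_le [IsProbabilityMeasure μ] {T : Ω → ℝ} {C : ℝ}
    (hC : ∀ ω, |T ω| ≤ C) : -outerExpectation μ (fun ω => -T ω) ≤ outerExpectation μ T := by
  refine le_of_forall_pos_le_add fun ε hε => ?_
  obtain ⟨U, -, hUi, hTU, hU⟩ := exists_majorant_of_outerExpectation_lt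
    (fun ω => (abs_le.1 (hC ω)).2) (lt_add_of_pos_right (outerExpectation μ T) (half_pos hε))
  obtain ⟨V, -, hVi, hTV, hV⟩ := exists_majorant_of_outerExpectation_lt
    (T := fun ω => -T ω) (C := C) (fun ω => by linarith [(abs_le.1 (hC ω)).1])
    (lt_add_of_pos_right (outerExpectation μ fun ω => -T ω) (half_pos hε))
  have h : 0 ≤ ∫ ω, U ω + V ω ∂μ :=
    integral_nonneg fun ω => by simpa using by linarith [hTU ω, hTV ω]
  rw [integral_add hUi hVi] at h
  linarith

lemma outerExpectation_add_const [IsProbabilityMeasure μ] {T : Ω → ℝ} {C : ℝ}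
    (hC : ∀ ω, |T ω| ≤ C) (c : ℝ) :
    outerExpectation μ (fun ω => T ω + c) = outerExpectation μ T + c := by
  refine le_antisymm ?_ ?_ <;> refine le_of_forall_pos_le_add fun ε hε => ?_
  · obtain ⟨U, hUm, hUi, hTU, hU⟩ := exists_majorant_of_outerExpectation_lt
      (fun ω => (abs_le.1 (hC ω)).2) (lt_add_of_pos_right (outerExpectation μ T) hε)
    have h := outerExpectation_le (μ := μ) (T := fun ω => T ω + c) (c := -C + c)
      (fun ω => by linarith [(abs_le.1 (hC ω)).1]) (hUm.add_const c)
      (hUi.add (integrable_const c)) (fun ω => by simpa using hTU ω)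
    rw [integral_add hUi (integrable_const c)] at h
    simp only [integral_const, probReal_univ, smul_eq_mul, one_mul] at h
    linarith
  · obtain ⟨U, hUm, hUi, hTU, hU⟩ := exists_majorant_of_outerExpectation_lt
      (T := fun ω => T ω + c) (C := C + c) (fun ω => by linarith [(abs_le.1 (hC ω)).2])
      (lt_add_of_pos_right (outerExpectation μ fun ω => T ω + c) hε)
    have h := outerExpectation_le (μ := μ) (T := T) (c := -C)
      (fun ω => (abs_le.1 (hC ω)).1) (hUm.add_const (-c))
      (hUi.add (integrable_const (-c))) (fun ω => by linarith [hTU ω])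
    rw [integral_add hUi (integrable_const _)] at h
    simp only [integral_const, probReal_univ, smul_eq_mul, one_mul] at h
    linarith

end OuterExpectation

/-- A finite partition of unity on a compact set by bounded continuous functions of small
support. -/
lemma IsCompact.exists_finset_boundedContinuousFunction {E : Type*} [MetricSpace E] {K : Set E}
    (hK : IsCompact K) {δ : ℝ} (hδ : 0 < δ) :
    ∃ (t : Finset E) (φ : E → E →ᵇ ℝ), ↑t ⊆ K ∧ (∀ i x, 0 ≤ φ i x) ∧
      (∀ i ∈ t, ∀ x, φ i x ≠ 0 → dist i x < δ) ∧ (∀ x, ∑ i ∈ t, φ i x ≤ 1) ∧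
      ∀ x ∈ K, ∑ i ∈ t, φ i x = 1 := by
  classical
  obtain ⟨t, htK, ht, hKt⟩ := hK.finite_cover_balls hδ
  lift t to Finset E using ht
  obtain ⟨f, hf⟩ := PartitionOfUnity.exists_isSubordinate_of_locallyFinite hK.isClosed
    (fun i : t => Metric.ball (i : E) δ) (fun _ => Metric.isOpen_ball)
    (locallyFinite_of_finite _) (by simpa [Set.iUnion_subtype] using hKt)
  have h1 : ∀ i x, |f i x| ≤ 1 := fun i x => by
    rw [abs_of_nonneg (f.nonneg i x)]; exact f.le_one i x
  have hsum : ∀ x, ∑ i ∈ t, (if h : i ∈ t then f ⟨i, h⟩ x else 0) = ∑ᶠ i, f i x := fun x => by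
    rw [finsum_eq_sum_of_fintype, ← Finset.sum_attach]
    simp
  refine ⟨t, fun i => if h : i ∈ t then
    BoundedContinuousFunction.ofNormedAddCommGroup (f ⟨i, h⟩) (f ⟨i, h⟩).continuous 1 (h1 _)
    else 0, htK, fun i x => ?_, fun i hi x hx => ?_, fun x => ?_, fun x hx => ?_⟩
  · dsimp only
    split_ifs with h
    · exact f.nonneg _ x
    · simp
  · simp only [hi, dite_true] at hx
    have := hf ⟨i, hi⟩ (subset_tsupport _ hx)
    rwa [Metric.mem_ball, dist_comm] at this
  · refine le_trans (le_of_eq ?_) (f.sum_le_one x)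
    rw [← hsum]
    exact Finset.sum_congr rfl fun i hi => by simp [hi]
  · refine Eq.trans ?_ (f.sum_eq_one hx)
    rw [← hsum]
    exact Finset.sum_congr rfl fun i hi => by simp [hi]

/-! ### Weak convergence of independent combinations -/

section Convergence

variable {Ω Ω' S₁ S₂ E : Type*} [MeasurableSpace Ω] [MeasurableSpace Ω'] [MeasurableSpace S₁]
  [MeasurableSpace S₂] [NormedAddCommGroup E] {μ : Measure Ω} {μ' : Measure Ω'}
  [IsProbabilityMeasure μ] [IsProbabilityMeasure μ']

/-- Weak convergence provides measurable majorants along the pulled back sequence. -/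
lemma WeaklyConvergesTo.eventually_exists_majorant {X : Ω → S₁} (hX : Measurable X)
    {A : ℕ → S₁ → E} [MeasurableSpace E] {ν : Measure E}
    (hA : WeaklyConvergesTo (μ.map X) A ν) (φ : E →ᵇ ℝ) {r : ℝ}
    (hr : ∫ z, φ z ∂ν < r) :
    ∀ᶠ k in atTop, ∃ U : S₁ → ℝ, Measurable U ∧ Integrable (fun ω => U (X ω)) μ ∧
      (∀ x, φ (A k x) ≤ U x) ∧ ∫ ω, U (X ω) ∂μ < r := by
  have := Measure.isProbabilityMeasure_map (μ := μ) hX.aemeasurable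
  filter_upwards [(hA φ).eventually_lt_const hr] with k hk
  -- The majorant is taken on `S₁`, not on `Ω`: then `U ∘ X` is a function of `X` alone and inherits
  -- independence from `Y`.
  obtain ⟨U, hU, hUi, hTU, h⟩ := exists_majorant_of_outerExpectation_lt (C := ‖φ‖)
    (fun x => (le_abs_self _).trans (φ.norm_coe_le_norm (A k x))) hk
  refine ⟨U, hU, hUi.comp_measurable hX, hTU, ?_⟩
  rwa [integral_map hX.aemeasurable hU.aestronglyMeasurable] at h

/-- A finite family version of `WeaklyConvergesTo.eventually_exists_majorant`. -/
lemma WeaklyConvergesTo.eventually_exists_majorants {X : Ω → S₁} (hX : Measurable X)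
    {A : ℕ → S₁ → E} [MeasurableSpace E] {ν : Measure E}
    (hA : WeaklyConvergesTo (μ.map X) A ν) {ι : Type*}
    (t : Finset ι) (φ : ι → E →ᵇ ℝ) {τ : ℝ} (hτ : 0 < τ) :
    ∀ᶠ k in atTop, ∃ U : ι → S₁ → ℝ, ∀ i ∈ t, Measurable (U i) ∧
      Integrable (fun ω => U i (X ω)) μ ∧ (∀ x, φ i (A k x) ≤ U i x) ∧
      ∫ ω, U i (X ω) ∂μ < ∫ z, φ i z ∂ν + τ := by
  filter_upwards [(Finset.eventually_all t).2 fun i _ =>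
    hA.eventually_exists_majorant hX (φ i) (lt_add_of_pos_right _ hτ)] with k hk
  choose! U hU using hk
  exact ⟨U, hU⟩

variable [NormedSpace ℝ E]

/-- Continuity is uniform at the compact set `K ×ˢ L ×ˢ {c}`, even when only one of the two compared
points lies in it. -/
lemma IsCompact.exists_forall_abs_sub_smul_lt {h : E → ℝ} (hh : Continuous h) {K L : Set E}
    (hK : IsCompact K) (hL : IsCompact L) (c : ℝ) {η : ℝ} (hη : 0 < η) :
    ∃ δ > 0, ∀ x ∈ K, ∀ y ∈ L, ∀ z w : E, ∀ d : ℝ, dist x z < δ → dist y w < δ → dist c d < δ →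
      |h (x - c • y) - h (z - d • w)| < η := by
  have hc : Continuous fun p : E × E × ℝ => h (p.1 - p.2.2 • p.2.1) := by fun_prop
  have := (hK.prod (hL.prod (isCompact_singleton (x := c)))).uniformContinuousAt_of_continuousAt
    _ (fun p _ => hc.continuousAt) (Metric.dist_mem_uniformity hη)
  obtain ⟨δ, hδ, H⟩ := Metric.mem_uniformity_dist.1 this
  refine ⟨δ, hδ, fun x hx y hy z w d hz hw hd => ?_⟩
  have := @H (x, y, c) (z, w, d) (by simp [Prod.dist_eq, hz, hw, hd]) (by simp [hx, hy])
  simpa [Real.dist_eq] using this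

variable [MeasurableSpace E] [BorelSpace E]

/-- The upper bound in the convergence of `A k - c k • B k` for independent sequences
with tight limits. -/
lemma WeaklyConvergesTo.eventually_outerExpectation_sub_smul_le
    {X : Ω → S₁} {Y : Ω → S₂} (hX : Measurable X) (hY : Measurable Y) (hXY : IndepFun X Y μ)
    {A : ℕ → S₁ → E} {B : ℕ → S₂ → E} {G H : Ω' → E} (hG : Measurable G) (hH : Measurable H)
    (hGH : IndepFun G H μ') {c : ℕ → ℝ} {l : ℝ} (hc : Tendsto c atTop (𝓝 l))
    (hGHm : Measurable fun ω => G ω - l • H ω)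
    (hGt : IsTightMeasureSet {μ'.map G}) (hHt : IsTightMeasureSet {μ'.map H})
    (hA : WeaklyConvergesTo (μ.map X) A (μ'.map G))
    (hB : WeaklyConvergesTo (μ.map Y) B (μ'.map H)) (h : E →ᵇ ℝ) (h0 : ∀ z, 0 ≤ h z)
    {ε : ℝ} (hε : 0 < ε) :
    ∀ᶠ k in atTop, outerExpectation μ (fun ω => h (A k (X ω) - c k • B k (Y ω))) ≤
      ∫ ω, h (G ω - l • H ω) ∂μ' + ε := by
  have := Measure.isProbabilityMeasure_map (μ := μ') hG.aemeasurable
  have := Measure.isProbabilityMeasure_map (μ := μ') hH.aemeasurable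
  set M := ‖h‖
  have hM0 : 0 ≤ M := norm_nonneg _
  have hhM : ∀ z, h z ≤ M := fun z => (le_abs_self _).trans (h.norm_coe_le_norm z)
  -- Error budget: `2 * η` for discretising the limit, `2 * M * η` for the mass off `K` and `L`, and
  -- `η` for the slack `τ` in the majorants.
  obtain ⟨η, hη, hηε⟩ : ∃ η > 0, (3 + 2 * M) * η = ε :=
    ⟨ε / (3 + 2 * M), by positivity, by field_simp⟩
  -- compact sets carrying almost all the mass of the limits
  have hcompact : ∀ {ν : Measure E} [IsProbabilityMeasure ν], IsTightMeasureSet {ν} →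
      ∃ K : Set E, IsCompact K ∧ ν.real Kᶜ ≤ η := by
    intro ν _ hν
    obtain ⟨K, hK, hKν⟩ := isTightMeasureSet_iff_exists_isCompact_measure_compl_le.1 hν
      (ENNReal.ofReal η) (by simpa using hη)
    refine ⟨K, hK, ?_⟩
    rw [measureReal_def]
    exact ENNReal.toReal_le_of_le_ofReal hη.le (hKν ν rfl)
  obtain ⟨K, hK, hKη⟩ := hcompact hGt
  obtain ⟨L, hL, hLη⟩ := hcompact hHt
  obtain ⟨δ, hδ, hclose⟩ := hK.exists_forall_abs_sub_smul_lt h.continuous hL l hη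
  obtain ⟨s, φ, hsK, hφ0, hφδ, hφ1, hφK⟩ := hK.exists_finset_boundedContinuousFunction hδ
  obtain ⟨t, ψ, htL, hψ0, hψδ, hψ1, hψL⟩ := hL.exists_finset_boundedContinuousFunction hδ
  let φ' : E →ᵇ ℝ := 1 - ∑ i ∈ s, φ i
  let ψ' : E →ᵇ ℝ := 1 - ∑ j ∈ t, ψ j
  have hφ' : ∀ x, φ' x = 1 - ∑ i ∈ s, φ i x := fun x => by simp [φ']
  have hψ' : ∀ x, ψ' x = 1 - ∑ i ∈ t, ψ i x := fun x => by simp [ψ']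
  have hint : ∀ {ν : Measure E} [IsProbabilityMeasure ν] {K : Set E} {f : E →ᵇ ℝ}, IsCompact K →
      (∀ x, f x ≤ 1) → (∀ x ∈ K, f x = 0) → ν.real Kᶜ ≤ η → ∫ x, f x ∂ν ≤ η := by
    intro ν _ K f hK hf1 hf0 hν
    refine le_trans ?_ hν
    rw [← integral_indicator_one hK.measurableSet.compl]
    refine integral_mono (f.integrable ν) ?_ fun x => ?_
    · exact (integrable_const (1 : ℝ)).indicator hK.measurableSet.compl
    · by_cases hx : x ∈ K
      · simp [hx, hf0 x hx]
      · simpa [hx] using hf1 x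
  have hφ'η : ∫ z, φ' z ∂(μ'.map G) ≤ η :=
    hint hK (fun x => by rw [hφ']; linarith [Finset.sum_nonneg fun i (_ : i ∈ s) => hφ0 i x])
      (fun x hx => by rw [hφ', hφK x hx, sub_self]) hKη
  have hψ'η : ∫ z, ψ' z ∂(μ'.map H) ≤ η :=
    hint hL (fun x => by rw [hψ']; linarith [Finset.sum_nonneg fun i (_ : i ∈ t) => hψ0 i x])
      (fun x hx => by rw [hψ', hψL x hx, sub_self]) hLη
  -- The added `η` makes `a i j` dominate `h` near the grid point; `h0` makes it nonnegative, so
  -- majorants may be inserted in the products.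
  let a : E → E → ℝ := fun i j => h (i - l • j) + η
  have ha0 : ∀ i j, 0 ≤ a i j := fun i j => add_nonneg (h0 _) hη.le
  let p : E → ℝ := fun i => ∫ z, φ i z ∂(μ'.map G)
  let q : E → ℝ := fun j => ∫ z, ψ j z ∂(μ'.map H)
  have hp0 : ∀ i, 0 ≤ p i := fun i => integral_nonneg (hφ0 i)
  have hq0 : ∀ i, 0 ≤ q i := fun i => integral_nonneg (hψ0 i)
  have hprod : ∀ x y, (∑ i ∈ s, ∑ j ∈ t, φ i x * ψ j y) = (∑ i ∈ s, φ i x) * ∑ j ∈ t, ψ j y :=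
    fun x y => (Finset.sum_mul_sum _ _ _ _).symm
  -- the discretised limit is close to the limit
  have hlim : ∑ i ∈ s, ∑ j ∈ t, a i j * (p i * q j) ≤ ∫ ω, h (G ω - l • H ω) ∂μ' + 2 * η := by
    have hi : ∀ i j, Integrable (fun ω => φ i (G ω) * ψ j (H ω)) μ' := fun i j =>
      .of_bound (((φ i).continuous.measurable.comp hG).mul
        ((ψ j).continuous.measurable.comp hH)).aestronglyMeasurable (‖φ i‖ * ‖ψ j‖)
        (.of_forall fun ω => by
          rw [norm_mul]
          gcongr
          exacts [(φ i).norm_coe_le_norm _, (ψ j).norm_coe_le_norm _])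
    have hpq : ∀ i j, p i * q j = ∫ ω, φ i (G ω) * ψ j (H ω) ∂μ' := fun i j => by
      rw [hGH.integral_fun_comp_mul_comp hG.aemeasurable hH.aemeasurable
        (φ i).continuous.measurable.aestronglyMeasurable
        (ψ j).continuous.measurable.aestronglyMeasurable]
      simp only [p, q]
      rw [integral_map hG.aemeasurable (φ i).continuous.measurable.aestronglyMeasurable,
        integral_map hH.aemeasurable (ψ j).continuous.measurable.aestronglyMeasurable]
    have hhi : Integrable (fun ω => h (G ω - l • H ω)) μ' :=
      .of_bound (h.continuous.measurable.comp hGHm).aestronglyMeasurable M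
        (.of_forall fun ω => h.norm_coe_le_norm _)
    simp_rw [hpq, ← integral_const_mul]
    rw [← Finset.sum_congr rfl fun i _ =>
        integral_finsetSum t fun j _ => (hi i j).const_mul (a i j),
      ← integral_finsetSum s fun i _ =>
        integrable_finsetSum t fun j _ => (hi i j).const_mul (a i j)]
    rw [show ∫ ω, h (G ω - l • H ω) ∂μ' + 2 * η = ∫ ω, (h (G ω - l • H ω) + 2 * η) ∂μ' by
      rw [integral_add hhi (integrable_const _)]; simp]
    refine integral_mono (integrable_finsetSum s fun i _ => integrable_finsetSum t fun j _ =>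
      (hi i j).const_mul (a i j)) (hhi.add (integrable_const _)) fun ω => ?_
    calc ∑ i ∈ s, ∑ j ∈ t, a i j * (φ i (G ω) * ψ j (H ω))
        ≤ ∑ i ∈ s, ∑ j ∈ t, (h (G ω - l • H ω) + 2 * η) * (φ i (G ω) * ψ j (H ω)) := by
          refine Finset.sum_le_sum fun i hi => Finset.sum_le_sum fun j hj => ?_
          by_cases hφi : φ i (G ω) = 0
          · simp [hφi]
          by_cases hψj : ψ j (H ω) = 0
          · simp [hψj]
          refine mul_le_mul_of_nonneg_right ?_ (mul_nonneg (hφ0 _ _) (hψ0 _ _))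
          have := abs_lt.1 (hclose i (hsK hi) j (htL hj) (G ω) (H ω) l (hφδ i hi _ hφi)
            (hψδ j hj _ hψj) (by simpa using hδ))
          simp only [a]
          linarith
      _ = (h (G ω - l • H ω) + 2 * η) * ((∑ i ∈ s, φ i (G ω)) * ∑ j ∈ t, ψ j (H ω)) := by
          rw [← hprod]; simp_rw [Finset.mul_sum]
      _ ≤ h (G ω - l • H ω) + 2 * η :=
          mul_le_of_le_one_right (add_nonneg (h0 _) (by positivity))
            (mul_le_one₀ (hφ1 _) (Finset.sum_nonneg fun j _ => hψ0 j _) (hψ1 _))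
  -- pointwise discretisation of the converging sequence
  have hpt : ∀ z w d, dist l d < δ → h (z - d • w) ≤
      ∑ i ∈ s, ∑ j ∈ t, a i j * (φ i z * ψ j w) + M * φ' z + M * ψ' w := by
    intro z w d hd
    have h1 : h (z - d • w) * ((∑ i ∈ s, φ i z) * ∑ j ∈ t, ψ j w) ≤
        ∑ i ∈ s, ∑ j ∈ t, a i j * (φ i z * ψ j w) := by
      rw [← hprod]
      simp_rw [Finset.mul_sum]
      refine Finset.sum_le_sum fun i hi => Finset.sum_le_sum fun j hj => ?_
      by_cases hφi : φ i z = 0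
      · simp [hφi]
      by_cases hψj : ψ j w = 0
      · simp [hψj]
      refine mul_le_mul_of_nonneg_right ?_ (mul_nonneg (hφ0 _ _) (hψ0 _ _))
      have := abs_lt.1 (hclose i (hsK hi) j (htL hj) z w d (hφδ i hi _ hφi) (hψδ j hj _ hψj) hd)
      simp only [a]
      linarith
    have hΦ := hφ1 z
    have hΨ := hψ1 w
    have hΦ0 := Finset.sum_nonneg fun i (_ : i ∈ s) => hφ0 i z
    have hΨ0 := Finset.sum_nonneg fun i (_ : i ∈ t) => hψ0 i w
    rw [hφ', hψ']
    set Φ := ∑ i ∈ s, φ i z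
    set Ψ := ∑ j ∈ t, ψ j w
    have h2 : h (z - d • w) * (1 - Φ * Ψ) ≤ M * (1 - Φ * Ψ) :=
      mul_le_mul_of_nonneg_right (hhM _) (sub_nonneg.2 (mul_le_one₀ hΦ hΨ0 hΨ))
    -- The two sides differ by `M * ((1 - Φ) * (1 - Ψ))`, which is nonnegative.
    have h3 : M * (1 - Φ * Ψ) ≤ M * ((1 - Φ) + (1 - Ψ)) :=
      mul_le_mul_of_nonneg_left
        (by nlinarith [mul_nonneg (sub_nonneg.2 hΦ) (sub_nonneg.2 hΨ)]) hM0
    linarith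
  -- a small slack for the majorants
  obtain ⟨τ, hτ, hτη⟩ : ∃ τ > 0, ∑ i ∈ s, ∑ j ∈ t, a i j * ((p i + τ) * (q j + τ))
      + M * (η + τ) + M * (η + τ) <
      ∑ i ∈ s, ∑ j ∈ t, a i j * (p i * q j) + M * η + M * η + η := by
    have hcont : Continuous fun τ : ℝ => ∑ i ∈ s, ∑ j ∈ t, a i j * ((p i + τ) * (q j + τ))
      + M * (η + τ) + M * (η + τ) := by fun_prop
    have := (hcont.tendsto 0).eventually_lt_const
      (u := ∑ i ∈ s, ∑ j ∈ t, a i j * (p i * q j) + M * η + M * η + η) (by simpa using hη)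
    obtain ⟨τ, h1, h2⟩ := ((this.filter_mono nhdsWithin_le_nhds).and
      (self_mem_nhdsWithin (s := Set.Ioi (0 : ℝ)))).exists
    exact ⟨τ, h2, h1⟩
  filter_upwards [hA.eventually_exists_majorants hX s φ hτ,
    hB.eventually_exists_majorants hY t ψ hτ,
    hA.eventually_exists_majorant hX φ' (lt_add_of_pos_right _ hτ),
    hB.eventually_exists_majorant hY ψ' (lt_add_of_pos_right _ hτ),
    hc.eventually (Metric.ball_mem_nhds l hδ)] with k hU hV hU' hV' hck
  obtain ⟨U, hU⟩ := hU
  obtain ⟨V, hV⟩ := hV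
  obtain ⟨U', hU'm, hU'i, hU'le, hU'lt⟩ := hU'
  obtain ⟨V', hV'm, hV'i, hV'le, hV'lt⟩ := hV'
  -- Nonnegativity allows the majorants of the two factors to be multiplied.
  have hU0 : ∀ i ∈ s, ∀ x, 0 ≤ U i x := fun i hi x => (hφ0 i _).trans ((hU i hi).2.2.1 x)
  have hV0 : ∀ i ∈ t, ∀ x, 0 ≤ V i x := fun i hi x => (hψ0 i _).trans ((hV i hi).2.2.1 x)
  have hUVi : ∀ i ∈ s, ∀ j ∈ t, Integrable (fun ω => a i j * (U i (X ω) * V j (Y ω))) μ :=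
    fun i hi j hj => ((hXY.comp (hU i hi).1 (hV j hj).1).integrable_mul (hU i hi).2.1
      (hV j hj).2.1).const_mul _
  have hUVi' : ∀ i ∈ s, Integrable (fun ω => ∑ j ∈ t, a i j * (U i (X ω) * V j (Y ω))) μ :=
    fun i hi => integrable_finsetSum t fun j hj => hUVi i hi j hj
  have hUVi'' : Integrable (fun ω => ∑ i ∈ s, ∑ j ∈ t, a i j * (U i (X ω) * V j (Y ω))) μ :=
    integrable_finsetSum s hUVi'
  have hUVi₃ : Integrable (fun ω => ∑ i ∈ s, ∑ j ∈ t, a i j * (U i (X ω) * V j (Y ω))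
      + M * U' (X ω)) μ := hUVi''.add (hU'i.const_mul M)
  have key := outerExpectation_le (μ := μ) (c := 0)
    (T := fun ω => h (A k (X ω) - c k • B k (Y ω)))
    (U := fun ω => ∑ i ∈ s, ∑ j ∈ t, a i j * (U i (X ω) * V j (Y ω)) + M * U' (X ω)
      + M * V' (Y ω)) (fun ω => h0 _) ?_ (hUVi₃.add (hV'i.const_mul M)) ?_
  · refine key.trans ?_
    have e1 : ∫ ω, ∑ i ∈ s, ∑ j ∈ t, a i j * (U i (X ω) * V j (Y ω)) ∂μ ≤
        ∑ i ∈ s, ∑ j ∈ t, a i j * ((p i + τ) * (q j + τ)) := by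
      rw [integral_finsetSum s hUVi']
      refine Finset.sum_le_sum fun i hi => ?_
      rw [integral_finsetSum t (hUVi i hi)]
      refine Finset.sum_le_sum fun j hj => ?_
      rw [integral_const_mul]
      refine mul_le_mul_of_nonneg_left ?_ (ha0 i j)
      rw [hXY.integral_fun_comp_mul_comp hX.aemeasurable hY.aemeasurable
        (hU i hi).1.aestronglyMeasurable (hV j hj).1.aestronglyMeasurable]
      exact mul_le_mul (hU i hi).2.2.2.le (hV j hj).2.2.2.le
        (integral_nonneg fun ω => hV0 j hj _) (add_nonneg (hp0 i) hτ.le)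
    rw [integral_add hUVi₃ (hV'i.const_mul M),
      integral_add hUVi'' (hU'i.const_mul M), integral_const_mul, integral_const_mul]
    have e2 := mul_le_mul_of_nonneg_left (hU'lt.le.trans (add_le_add_left hφ'η τ)) hM0
    have e3 := mul_le_mul_of_nonneg_left (hV'lt.le.trans (add_le_add_left hψ'η τ)) hM0
    linarith
  · refine ((Finset.measurable_sum s fun i hi => Finset.measurable_sum t fun j hj => ?_).add
      ((hU'm.comp hX).const_mul M)).add ((hV'm.comp hY).const_mul M)
    exact (((hU i hi).1.comp hX).mul ((hV j hj).1.comp hY)).const_mul _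
  · intro ω
    refine (hpt _ _ _ (by rwa [dist_comm])).trans ?_
    gcongr with i hi j hj
    · exact ha0 i j
    · exact hψ0 _ _
    · exact hU0 i hi _
    · exact (hU i hi).2.2.1 _
    · exact (hV j hj).2.2.1 _
    · exact hU'le _
    · exact hV'le _

/-- If `A k` and `B k` converge weakly to tight limits and are evaluated at independent random
elements, then `A k - c k • B k` converges weakly to the law of `G - l • H`, with `G`, `H`
independent copies of the limits and `l = lim c k`. -/
theorem WeaklyConvergesTo.sub_smul_of_indepFun
    {X : Ω → S₁} {Y : Ω → S₂} (hX : Measurable X) (hY : Measurable Y) (hXY : IndepFun X Y μ)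
    {A : ℕ → S₁ → E} {B : ℕ → S₂ → E} {G H : Ω' → E} (hG : Measurable G) (hH : Measurable H)
    (hGH : IndepFun G H μ') {c : ℕ → ℝ} {l : ℝ} (hc : Tendsto c atTop (𝓝 l))
    (hGHm : Measurable fun ω => G ω - l • H ω)
    (hGt : IsTightMeasureSet {μ'.map G}) (hHt : IsTightMeasureSet {μ'.map H})
    (hA : WeaklyConvergesTo (μ.map X) A (μ'.map G))
    (hB : WeaklyConvergesTo (μ.map Y) B (μ'.map H)) :
    WeaklyConvergesTo μ (fun k ω => A k (X ω) - c k • B k (Y ω))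
      (μ'.map fun ω => G ω - l • H ω) := by
  have upper : ∀ h : E →ᵇ ℝ, ∀ ε > 0, ∀ᶠ k in atTop,
      outerExpectation μ (fun ω => h (A k (X ω) - c k • B k (Y ω))) ≤
        ∫ ω, h (G ω - l • H ω) ∂μ' + ε := by
    intro h ε hε
    -- Adding the constant `‖h‖` makes the test function nonnegative; it cancels from both sides
    -- afterwards.
    have h1 := WeaklyConvergesTo.eventually_outerExpectation_sub_smul_le hX hY hXY hG hH hGH hc
      hGHm hGt hHt hA hB (h + BoundedContinuousFunction.const E ‖h‖)
      (fun z => by simpa using by linarith [(abs_le.1 (h.norm_coe_le_norm z)).1]) hε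
    filter_upwards [h1] with k hk
    simp only [BoundedContinuousFunction.coe_add, Pi.add_apply,
      BoundedContinuousFunction.const_apply] at hk
    have hhi : Integrable (fun ω => h (G ω - l • H ω)) μ' :=
      .of_bound (h.continuous.measurable.comp hGHm).aestronglyMeasurable ‖h‖
        (.of_forall fun ω => h.norm_coe_le_norm _)
    rw [outerExpectation_add_const fun ω => h.norm_coe_le_norm _,
      integral_add hhi (integrable_const _)] at hk
    simp only [integral_const, probReal_univ, smul_eq_mul, one_mul] at hk
    linarith
  intro h
  rw [integral_map hGHm.aemeasurable h.continuous.measurable.aestronglyMeasurable]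
  refine tendsto_order.2 ⟨fun b hb => ?_, fun b hb => ?_⟩
  · filter_upwards [upper (-h) ((∫ ω, h (G ω - l • H ω) ∂μ' - b) / 2) (by linarith)] with k hk
    simp only [BoundedContinuousFunction.coe_neg, Pi.neg_apply, integral_neg] at hk
    have := neg_outerExpectation_neg_le (μ := μ)
      (T := fun ω => h (A k (X ω) - c k • B k (Y ω))) fun ω => h.norm_coe_le_norm _
    linarith
  · filter_upwards [upper h ((b - ∫ ω, h (G ω - l • H ω) ∂μ') / 2) (by linarith)] with k hk
    linarith

end Convergence

/-! ### Coordinates of `ℓ^∞(F)` -/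

section EllInf

variable {X : Type u} {F : Set (X → ℝ)}

lemma EllInf.continuous_apply (f : F) : Continuous fun z : EllInf F => z f :=
  (lp.lipschitzWith_one_eval ∞ f).continuous

lemma memℓp_infty_of_abs_le {z : F → ℝ} {C : ℝ} (hC : ∀ f, |z f| ≤ C) : Memℓp z ∞ :=
  memℓp_infty ⟨C, by rintro _ ⟨f, rfl⟩; exact hC f⟩

lemma toEllInf_eq {z : F → ℝ} (hz : Memℓp z ∞) : toEllInf z = (⟨z, hz⟩ : EllInf F) :=
  dif_pos hz

lemma toEllInf_apply {z : F → ℝ} (hz : Memℓp z ∞) (f : F) : toEllInf z f = z f := by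
  rw [toEllInf_eq hz]

end EllInf

/-! ### Empirical processes and Brownian bridges -/

section Empirical

variable {X : Type u} [MeasurableSpace X] {F : Set (X → ℝ)} {P : Measure X}

lemma empiricalProcess_eq (n : ℕ) (x : ℕ → X) (f : F) :
    empiricalProcess P F n x f =
      (√(n : ℝ))⁻¹ * ∑ i ∈ Finset.range n, ((f : X → ℝ) (x i) - ∫ t, (f : X → ℝ) t ∂P) := by
  rcases n.eq_zero_or_pos with rfl | hn
  · simp [empiricalProcess]
  have hn' : (0 : ℝ) < n := by exact_mod_cast hn
  have hs : √(n : ℝ) ≠ 0 := (Real.sqrt_pos.2 hn').ne'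
  simp only [empiricalProcess, sampleMean, Finset.sum_sub_distrib, Finset.sum_const,
    Finset.card_range, nsmul_eq_mul]
  field_simp
  rw [Real.sq_sqrt hn'.le]

/-- For `n = 0` the ratio `m / n` is `0` by convention and would lose the term `√m * Pb f`. -/
lemma differenceProcess_eq {Pa Pb : Measure X} {m n : ℕ} (hn : n ≠ 0) (x y : ℕ → X) :
    differenceProcess Pa Pb F m n x y =
      empiricalProcess Pa F m x - √((m : ℝ) / n) • empiricalProcess Pb F n y := by
  ext f
  have hs : √((m : ℝ) / n) * √(n : ℝ) = √(m : ℝ) := by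
    rw [← Real.sqrt_mul (by positivity), div_mul_cancel₀ _ (by exact_mod_cast hn)]
  simp only [differenceProcess, empiricalProcess, Pi.sub_apply, Pi.smul_apply, smul_eq_mul,
    ← mul_assoc, hs]
  ring

variable [IsProbabilityMeasure P]

lemma IsDonsker.memℓp_empiricalProcess (hF : IsDonsker P F) (n : ℕ) (x : ℕ → X) :
    Memℓp (empiricalProcess P F n x) ∞ := by
  choose C hC using hF.bounded
  refine memℓp_infty_of_abs_le (C := (√(n : ℝ))⁻¹ * ∑ i ∈ Finset.range n, C (x i)) fun f => ?_
  rw [empiricalProcess_eq, abs_mul, abs_of_nonneg (by positivity : 0 ≤ (√(n : ℝ))⁻¹)]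
  gcongr
  exact (Finset.abs_sum_le_sum_abs _ _).trans (Finset.sum_le_sum fun i _ => hC _ _ f.2)

/-- The finite-dimensional distributions of the limit of the empirical process are the centered
Gaussian ones given by the central limit theorem. -/
lemma IsDonsker.map_sum_mul_eq_gaussianReal (hF : IsDonsker P F) {ν : Measure (EllInf F)}
    [IsProbabilityMeasure ν] (hν : WeaklyConvergesTo (Measure.infinitePi (fun _ : ℕ => P))
      (fun n x => toEllInf (empiricalProcess P F n x)) ν)
    {ι : Type*} [Fintype ι] (c : ι → ℝ) (f : ι → F) :
    ν.map (fun z => ∑ i, c i * z (f i)) =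
      gaussianReal 0 Var[fun x => ∑ i, c i * (f i : X → ℝ) x; P].toNNReal := by
  set g : X → ℝ := fun x => ∑ i, c i * (f i : X → ℝ) x with hg
  have hgm : Measurable g :=
    Finset.measurable_sum _ fun i _ => (hF.measurable _ (f i).2).const_mul _
  have hg2 : MemLp g 2 P := memLp_finsetSum _ fun i _ => (hF.memLp _ (f i).2).const_mul _
  have hφ : Continuous fun z : EllInf F => ∑ i, c i * z (f i) :=
    continuous_finsetSum _ fun i _ => continuous_const.mul (EllInf.continuous_apply _)
  have hgP : ∫ x, g x ∂P = ∑ i, c i * ∫ x, (f i : X → ℝ) x ∂P := by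
    simp only [hg]
    rw [integral_finsetSum _ fun i _ =>
      ((hF.memLp _ (f i).2).integrable (by norm_num)).const_mul _]
    simp_rw [integral_const_mul]
  set Q := Measure.infinitePi fun _ : ℕ => P
  have hev : ∀ i, MeasurePreserving (fun x : ℕ → X => x i) Q P :=
    fun i => measurePreserving_eval_infinitePi (fun _ : ℕ => P) i
  have hlaw : ∀ i, Q.map (fun x => g (x i)) = P.map g := fun i => by
    rw [← (hev i).map_eq, Measure.map_map hgm (hev i).measurable]; rfl
  have hvar : Var[fun x : ℕ → X => g (x 0); Q] = Var[g; P] := by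
    rw [← (hev 0).map_eq, variance_map hgm.aemeasurable (hev 0).measurable.aemeasurable]
    rfl
  have hmean : ∫ x : ℕ → X, g (x 0) ∂Q = ∫ x, g x ∂P := by
    rw [← (hev 0).map_eq, integral_map (hev 0).measurable.aemeasurable hgm.aestronglyMeasurable]
  have hclt := tendstoInDistribution_inv_sqrt_mul_sum_sub (P := Q)
    (X := fun (i : ℕ) (x : ℕ → X) => g (x i)) (Y := id)
    (P' := gaussianReal 0 Var[g; P].toNNReal) (by rw [hvar]; exact HasLaw.id)
    (hg2.comp_measurePreserving (hev 0))
    (iIndepFun_infinitePi (X := fun _ => g) fun _ => hgm)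
    (fun i => ⟨(hgm.comp (hev i).measurable).aemeasurable,
      (hgm.comp (hev 0).measurable).aemeasurable, by rw [hlaw, hlaw]⟩)
  have hZ : ∀ (n : ℕ) (x : ℕ → X),
      ∑ i, c i * toEllInf (empiricalProcess P F n x) (f i) =
        (√(n : ℝ))⁻¹ * (∑ k ∈ Finset.range n, g (x k) - n * ∫ x : ℕ → X, g (x 0) ∂Q) := by
    intro n x
    rw [hmean, hgP]
    simp_rw [toEllInf_apply (hF.memℓp_empiricalProcess n x), empiricalProcess_eq,
      Finset.sum_sub_distrib, hg]
    rw [Finset.sum_comm, Finset.mul_sum, ← Finset.sum_sub_distrib, Finset.mul_sum]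
    refine Finset.sum_congr rfl fun i _ => ?_
    rw [← Finset.mul_sum]
    simp
    ring
  have hmeas : ∀ n : ℕ, Measurable fun x : ℕ → X =>
      (√(n : ℝ))⁻¹ * (∑ k ∈ Finset.range n, g (x k) - n * ∫ x : ℕ → X, g (x 0) ∂Q) := fun n =>
    ((Finset.measurable_sum _ fun k _ => hgm.comp (hev k).measurable).sub_const _).const_mul _
  have := Measure.isProbabilityMeasure_map (μ := ν) hφ.measurable.aemeasurable
  refine ext_of_forall_integral_eq_of_IsFiniteMeasure fun h => ?_
  rw [integral_map hφ.measurable.aemeasurable h.continuous.measurable.aestronglyMeasurable]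
  -- The same sequence has two limits: one from the Donsker property, one from the central limit
  -- theorem. The linear combinations are measurable, so outer expectations are integrals.
  refine tendsto_nhds_unique (hν (h.compContinuous ⟨_, hφ⟩)) ?_
  have := ProbabilityMeasure.tendsto_iff_forall_integral_tendsto.1 hclt.tendsto h
  simp only [ProbabilityMeasure.coe_mk, Measure.map_id] at this
  refine this.congr fun n => ?_
  rw [integral_map (hmeas n).aemeasurable h.continuous.measurable.aestronglyMeasurable]
  simp only [BoundedContinuousFunction.compContinuous_apply, ContinuousMap.coe_mk, hZ]
  exact (outerExpectation_eq_integral (h.continuous.measurable.comp (hmeas n))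
    fun x => h.norm_coe_le_norm _).symm

/-- A random element whose law is a tight limit of the empirical process is a Brownian bridge. -/
lemma IsDonsker.isTightCenteredGaussian (hF : IsDonsker P F) {Ω : Type*} [MeasurableSpace Ω]
    {μ : Measure Ω} [IsProbabilityMeasure μ] {G : Ω → EllInf F} (hG : Measurable G)
    (hGt : IsTightMeasureSet {μ.map G})
    (hν : WeaklyConvergesTo (Measure.infinitePi (fun _ : ℕ => P))
      (fun n x => toEllInf (empiricalProcess P F n x)) (μ.map G)) :
    IsTightCenteredGaussian μ G (bridgeCov P) := by
  classical
  have := Measure.isProbabilityMeasure_map (μ := μ) hG.aemeasurable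
  have hGf : ∀ f, Measurable fun ω => G ω f :=
    fun f => (EllInf.continuous_apply f).measurable.comp hG
  have hmap : ∀ {ι : Type u} [Fintype ι] (c : ι → ℝ) (f : ι → F),
      μ.map (fun ω => ∑ i, c i * G ω (f i)) =
        gaussianReal 0 Var[fun x => ∑ i, c i * (f i : X → ℝ) x; P].toNNReal := by
    intro ι _ c f
    rw [← hF.map_sum_mul_eq_gaussianReal hν c f, Measure.map_map _ hG]
    · rfl
    · exact Finset.measurable_sum _ fun i _ =>
        ((EllInf.continuous_apply (f i)).measurable).const_mul _
  have hgauss : IsGaussianProcess (fun (f : F) ω => G ω f) μ := by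
    -- Cramér–Wold: a functional `L` on `I → ℝ` is the combination with coefficients `L (Pi.single i
    -- 1)`.
    refine ⟨fun I => ⟨isGaussian_of_map_eq_gaussianReal fun L =>
      ⟨0, Var[fun x => ∑ i : I, L (Pi.single i 1) * (i.1 : X → ℝ) x; P].toNNReal, ?_⟩⟩⟩
    have hr : Measurable fun ω => I.restrict fun f => G ω f :=
      measurable_pi_lambda _ fun i => hGf i
    rw [← hmap (fun i : I => L (Pi.single i 1)) fun i => i.1,
      Measure.map_map L.continuous.measurable hr]
    congr 1
    ext ω
    refine ((L : (I → ℝ) →ₗ[ℝ] ℝ).pi_apply_eq_sum_univ (I.restrict fun f => G ω f)).trans ?_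
    refine Finset.sum_congr rfl fun i _ => ?_
    rw [smul_eq_mul, mul_comm]
    exact congrArg (fun v : I → ℝ => L v * G ω i)
      (funext fun j => by simp [Pi.single_apply, eq_comm])
  have h2 : ∀ f, MemLp (fun ω => G ω f) 2 μ := fun f => (hgauss.hasGaussianLaw_eval f).memLp_two
  have hmean : ∀ f : F, ∫ ω, G ω f ∂μ = 0 := fun f => by
    have := hmap (ι := PUnit) (fun _ => 1) (fun _ => f)
    simp only [Finset.univ_unique, one_mul, Finset.sum_singleton] at this
    calc ∫ ω, G ω f ∂μ = ∫ x, x ∂(μ.map fun ω => G ω f) := by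
          rw [integral_map (hGf f).aemeasurable (by fun_prop)]
      _ = 0 := by rw [this, integral_id_gaussianReal]
  -- Polarisation: `s = 1` and `s = -1` together determine the covariance.
  have hvar : ∀ (s : ℝ) (f g : F), Var[fun ω => G ω f + s * G ω g; μ] =
      Var[fun x => (f : X → ℝ) x + s * (g : X → ℝ) x; P] := fun s f g => by
    have := hmap (ι := ULift (Fin 2)) (fun i => ![1, s] i.down) (fun i => ![f, g] i.down)
    simp only [← Equiv.ulift.symm.sum_comp, Fin.sum_univ_two] at this
    simp at this
    have hm : Measurable fun ω => G ω f + s * G ω g := (hGf f).add ((hGf g).const_mul s)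
    rw [← variance_id_map hm.aemeasurable, this, variance_id_gaussianReal,
      Real.coe_toNNReal _ (variance_nonneg _ _)]
  refine ⟨hG, hGt, hgauss, hmean, fun f g => ?_⟩
  have hf := hF.memLp _ f.2
  have hg := hF.memLp _ g.2
  have e1 := hvar 1 f g
  have e2 := hvar (-1) f g
  simp only [one_mul, neg_mul, ← sub_eq_add_neg] at e1 e2
  rw [variance_fun_add (h2 f) (h2 g), variance_fun_add hf hg] at e1
  rw [variance_fun_sub (h2 f) (h2 g), variance_fun_sub hf hg] at e2
  have e3 : cov[fun ω => G ω f, fun ω => G ω g; μ] = cov[(f : X → ℝ), (g : X → ℝ); P] := by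
    change _ = cov[fun x => (f : X → ℝ) x, fun x => (g : X → ℝ) x; P]
    linarith
  rw [covariance_eq_sub (h2 f) (h2 g), covariance_eq_sub hf hg] at e3
  simp only [hmean, mul_zero, sub_zero] at e3
  exact e3

end Empirical

/-! ### Construction and properties of the limit -/

section Limit

lemma IsTightCenteredGaussian.memLp_two {X : Type u} {F : Set (X → ℝ)} {Ω : Type*}
    [MeasurableSpace Ω] {μ : Measure Ω} {G : Ω → EllInf F} {K : F → F → ℝ}
    (hG : IsTightCenteredGaussian μ G K) (f : F) : MemLp (fun ω => G ω f) 2 μ :=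
  (hG.gaussian.hasGaussianLaw_eval f).memLp_two

/-- A linear combination of independent tight centered Gaussian elements of `ℓ^∞(F)`. -/
lemma IsTightCenteredGaussian.sub_smul {X : Type u} {F : Set (X → ℝ)} {Ω : Type*}
    [MeasurableSpace Ω] {μ : Measure Ω} [IsProbabilityMeasure μ] {G H : Ω → EllInf F}
    {K K' : F → F → ℝ} (hG : IsTightCenteredGaussian μ G K) (hH : IsTightCenteredGaussian μ H K')
    (hGH : IndepFun G H μ) (l : ℝ) (hm : Measurable fun ω => G ω - l • H ω) :
    IsTightCenteredGaussian μ (fun ω => G ω - l • H ω) (fun f g => K f g + l ^ 2 * K' f g) where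
  measurable := hm
  tight := by
    refine isTightMeasureSet_iff_exists_isCompact_measure_compl_le.2 fun ε hε => ?_
    obtain ⟨C, hC, hCε⟩ := isTightMeasureSet_iff_exists_isCompact_measure_compl_le.1 hG.tight
      (ε / 2) (ENNReal.half_pos hε.ne')
    obtain ⟨D, hD, hDε⟩ := isTightMeasureSet_iff_exists_isCompact_measure_compl_le.1 hH.tight
      (ε / 2) (ENNReal.half_pos hε.ne')
    -- The image of `C ×ˢ D` is compact and is missed only if `G` misses `C` or `H` misses `D`.
    have hcont : Continuous fun p : EllInf F × EllInf F => p.1 - l • p.2 := by fun_prop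
    have hCD := (hC.prod hD).image hcont
    refine ⟨_, hCD, ?_⟩
    rintro _ rfl
    have h1 := hCε _ rfl
    have h2 := hDε _ rfl
    rw [Measure.map_apply hG.measurable hC.measurableSet.compl] at h1
    rw [Measure.map_apply hH.measurable hD.measurableSet.compl] at h2
    rw [Measure.map_apply hm hCD.measurableSet.compl]
    calc μ _ ≤ μ (G ⁻¹' Cᶜ ∪ H ⁻¹' Dᶜ) := measure_mono fun ω hω => by
          by_contra hcon
          simp only [Set.mem_union, Set.mem_preimage, Set.mem_compl_iff, not_or, not_not] at hcon
          exact hω ⟨(G ω, H ω), hcon, rfl⟩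
      _ ≤ ε / 2 + ε / 2 := (measure_union_le _ _).trans (add_le_add h1 h2)
      _ = ε := ENNReal.add_halves ε
  gaussian := by
    refine ⟨fun I => ?_⟩
    have hr : Measurable fun z : EllInf F => I.restrict fun f => z f :=
      measurable_pi_lambda _ fun i => (EllInf.continuous_apply i.1).measurable
    have := iIndepFun.hasGaussianLaw_fun_sub (hG.gaussian.hasGaussianLaw I)
      ((hH.gaussian.smul fun _ => l).hasGaussianLaw I)
      (hGH.comp hr (hr.const_smul l))
    exact this
  mean_zero f := by
    simp only [lp.coeFn_sub, lp.coeFn_smul, Pi.sub_apply, Pi.smul_apply, smul_eq_mul]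
    rw [integral_sub ((hG.memLp_two f).integrable (by norm_num))
      (((hH.memLp_two f).integrable (by norm_num)).const_mul l), integral_const_mul,
      hG.mean_zero, hH.mean_zero]
    simp
  covariance f g := by
    have hcross : ∀ f g : F, ∫ ω, G ω f * H ω g ∂μ = 0 := fun f g => by
      rw [hGH.integral_fun_comp_mul_comp (f := fun z : EllInf F => z f)
        (g := fun z : EllInf F => z g) hG.measurable.aemeasurable hH.measurable.aemeasurable
        (EllInf.continuous_apply f).measurable.aestronglyMeasurable
        (EllInf.continuous_apply g).measurable.aestronglyMeasurable, hG.mean_zero, zero_mul]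
    have i1 : Integrable (fun ω => G ω f * G ω g) μ :=
      (hG.memLp_two f).integrable_mul (hG.memLp_two g)
    have i2 : Integrable (fun ω => l * (G ω f * H ω g)) μ :=
      ((hG.memLp_two f).integrable_mul (hH.memLp_two g)).const_mul l
    have i3 : Integrable (fun ω => l * (G ω g * H ω f)) μ :=
      ((hG.memLp_two g).integrable_mul (hH.memLp_two f)).const_mul l
    have i4 : Integrable (fun ω => l ^ 2 * (H ω f * H ω g)) μ :=
      ((hH.memLp_two f).integrable_mul (hH.memLp_two g)).const_mul (l ^ 2)
    have i12 := i1.sub i2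
    have i34 := i4.sub i3
    calc ∫ ω, (G ω - l • H ω) f * (G ω - l • H ω) g ∂μ
        = ∫ ω, (G ω f * G ω g - l * (G ω f * H ω g))
          + (l ^ 2 * (H ω f * H ω g) - l * (G ω g * H ω f)) ∂μ := by
          refine integral_congr_ae (.of_forall fun ω => ?_)
          simp only [lp.coeFn_sub, lp.coeFn_smul, Pi.sub_apply, Pi.smul_apply, smul_eq_mul]
          ring
      _ = (∫ ω, G ω f * G ω g ∂μ - l * ∫ ω, G ω f * H ω g ∂μ)
          + (l ^ 2 * ∫ ω, H ω f * H ω g ∂μ - l * ∫ ω, G ω g * H ω f ∂μ) := by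
          rw [← integral_const_mul, ← integral_const_mul, ← integral_const_mul]
          rw [← integral_sub i1 i2, ← integral_sub i4 i3]
          exact integral_add i12 i34
      _ = K f g + l ^ 2 * K' f g := by
          rw [hcross, hcross, hG.covariance, hH.covariance]
          ring

/-- A tight measure on a metric space is carried by a separable measurable set. -/
lemma IsTightMeasureSet.exists_isSeparable {E : Type*} [MetricSpace E] [MeasurableSpace E]
    [BorelSpace E] {ν : Measure E} (hν : IsTightMeasureSet {ν}) :
    ∃ S : Set E, MeasurableSet S ∧ TopologicalSpace.IsSeparable S ∧ ν Sᶜ = 0 := by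
  have h : ∀ n : ℕ, ∃ K : Set E, IsCompact K ∧ ν Kᶜ ≤ (n : ℝ≥0∞)⁻¹ := fun n => by
    obtain ⟨K, hK, hKν⟩ := isTightMeasureSet_iff_exists_isCompact_measure_compl_le.1 hν
      (n : ℝ≥0∞)⁻¹ (by simp)
    exact ⟨K, hK, hKν _ rfl⟩
  choose K hK hKν using h
  refine ⟨⋃ n, K n, .iUnion fun n => (hK n).measurableSet,
    .iUnion fun n => (hK n).isSeparable, ?_⟩
  refine le_antisymm (ge_of_tendsto' ENNReal.tendsto_inv_nat_nhds_zero fun n => ?_) zero_le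
  exact (measure_mono (Set.compl_subset_compl.2 (Set.subset_iUnion K n))).trans (hKν n)

/-- Tight laws are realised by independent random elements whose linear combinations are Borel
measurable. -/
lemma exists_indepFun_of_isTightMeasureSet {E : Type u} [NormedAddCommGroup E] [NormedSpace ℝ E]
    [MeasurableSpace E] [BorelSpace E] {ν₁ ν₂ : Measure E} [IsProbabilityMeasure ν₁]
    [IsProbabilityMeasure ν₂] (h₁ : IsTightMeasureSet {ν₁}) (h₂ : IsTightMeasureSet {ν₂}) :
    ∃ (Ω : Type u) (_ : MeasurableSpace Ω) (μ : Measure Ω) (G H : Ω → E),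
      IsProbabilityMeasure μ ∧ Measurable G ∧ Measurable H ∧ μ.map G = ν₁ ∧ μ.map H = ν₂ ∧
      IndepFun G H μ ∧ ∀ l : ℝ, Measurable fun ω => G ω - l • H ω := by
  -- On `E × E` the product σ-algebra may be smaller than the Borel one, and subtraction need not be
  -- measurable. On separable carriers `S` and `T` the two agree, so continuity suffices.
  obtain ⟨S, hS, hSsep, hSν⟩ := IsTightMeasureSet.exists_isSeparable h₁
  obtain ⟨T, hT, hTsep, hTν⟩ := IsTightMeasureSet.exists_isSeparable h₂
  have := hSsep.secondCountableTopology
  have := hTsep.secondCountableTopology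
  have hm₁ : (ν₁.comap ((↑) : S → E)).map (↑) = ν₁ := by
    rw [map_comap_subtype_coe hS, Measure.restrict_eq_self_of_ae_mem hSν]
  have hm₂ : (ν₂.comap ((↑) : T → E)).map (↑) = ν₂ := by
    rw [map_comap_subtype_coe hT, Measure.restrict_eq_self_of_ae_mem hTν]
  have hp₁ : IsProbabilityMeasure (ν₁.comap ((↑) : S → E)) :=
    (Measure.isProbabilityMeasure_map_iff measurable_subtype_coe.aemeasurable).1
      (by rw [hm₁]; infer_instance)
  have hp₂ : IsProbabilityMeasure (ν₂.comap ((↑) : T → E)) :=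
    (Measure.isProbabilityMeasure_map_iff measurable_subtype_coe.aemeasurable).1
      (by rw [hm₂]; infer_instance)
  refine ⟨S × T, inferInstance, (ν₁.comap (↑)).prod (ν₂.comap (↑)), fun p => p.1, fun p => p.2,
    inferInstance, measurable_subtype_coe.comp measurable_fst,
    measurable_subtype_coe.comp measurable_snd, ?_, ?_,
    indepFun_prod measurable_subtype_coe measurable_subtype_coe, fun l => ?_⟩
  · change Measure.map (Subtype.val ∘ Prod.fst) _ = _
    rw [← Measure.map_map measurable_subtype_coe measurable_fst, ← Measure.fst, Measure.fst_prod,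
      hm₁]
  · change Measure.map (Subtype.val ∘ Prod.snd) _ = _
    rw [← Measure.map_map measurable_subtype_coe measurable_snd, ← Measure.snd, Measure.snd_prod,
      hm₂]
  · have : Continuous fun p : S × T => (p.1 : E) - l • (p.2 : E) := by fun_prop
    exact this.measurable

end Limit

/-! ### Two-sample limit theorem -/

theorem mainTheorem4 {X : Type u} [MeasurableSpace X]
    (Pa Pb : Measure X) [IsProbabilityMeasure Pa] [IsProbabilityMeasure Pb]
    (F : Set (X → ℝ)) (hFa : IsDonsker Pa F) (hFb : IsDonsker Pb F)
    {Ω : Type v} [MeasurableSpace Ω] (μ : Measure Ω) [IsProbabilityMeasure μ]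
    (Ya Yb : ℕ → Ω → X)
    (hYa : ∀ i, Measurable (Ya i)) (hYb : ∀ i, Measurable (Yb i))
    (hYa_law : ∀ i, μ.map (Ya i) = Pa) (hYb_law : ∀ i, μ.map (Yb i) = Pb)
    (hYa_indep : iIndepFun Ya μ) (hYb_indep : iIndepFun Yb μ)
    (hYab : IndepFun (fun ω i => Ya i ω) (fun ω i => Yb i ω) μ)
    (na nb : ℕ → ℕ) (hna : Tendsto na atTop atTop) (hnb : Tendsto nb atTop atTop)
    (lam : ℝ) (hlam : Tendsto (fun k => √((na k : ℝ) / (nb k : ℝ))) atTop (𝓝 lam)) :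
    (∀ᶠ k in atTop, ∀ ω, Memℓp
      (differenceProcess Pa Pb F (na k) (nb k) (fun i => Ya i ω) (fun i => Yb i ω)) ∞) ∧
    ∃ (Ω' : Type u) (_ : MeasurableSpace Ω') (μ' : Measure Ω') (Ga Gb : Ω' → EllInf F),
      IsProbabilityMeasure μ' ∧
      IsTightCenteredGaussian μ' Ga (bridgeCov Pa) ∧
      IsTightCenteredGaussian μ' Gb (bridgeCov Pb) ∧
      IndepFun Ga Gb μ' ∧
      IsTightCenteredGaussian μ' (fun ω => Ga ω - lam • Gb ω)
        (fun f g => bridgeCov Pa f g + lam ^ 2 * bridgeCov Pb f g) ∧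
      WeaklyConvergesTo μ
        (fun k ω => toEllInf
          (differenceProcess Pa Pb F (na k) (nb k) (fun i => Ya i ω) (fun i => Yb i ω)))
        (μ'.map (fun ω => Ga ω - lam • Gb ω)) := by
  have hnb0 : ∀ᶠ k in atTop, nb k ≠ 0 := (hnb.eventually_gt_atTop 0).mono fun _ => ne_of_gt
  have hmem : ∀ (m n : ℕ) (x y : ℕ → X), Memℓp (empiricalProcess Pa F m x -
      √((m : ℝ) / n) • empiricalProcess Pb F n y) ∞ := fun m n x y =>
    (hFa.memℓp_empiricalProcess m x).sub ((hFb.memℓp_empiricalProcess n y).const_smul _)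
  refine ⟨hnb0.mono fun k hk ω => by rw [differenceProcess_eq hk]; exact hmem _ _ _ _, ?_⟩
  obtain ⟨νa, hνa, hνat, hνaw⟩ := hFa.exists_limit
  obtain ⟨νb, hνb, hνbt, hνbw⟩ := hFb.exists_limit
  obtain ⟨Ω', mΩ', μ', Ga, Gb, hμ', hGa, hGb, rfl, rfl, hind, hsub⟩ :=
    exists_indepFun_of_isTightMeasureSet hνat hνbt
  have hA := hFa.isTightCenteredGaussian hGa hνat hνaw
  have hB := hFb.isTightCenteredGaussian hGb hνbt hνbw
  refine ⟨Ω', mΩ', μ', Ga, Gb, hμ', hA, hB, hind, hA.sub_smul hB hind lam (hsub lam), ?_⟩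
  -- The iid sequence has the product law, so the Donsker hypothesis transfers from the coordinate
  -- sample to `Ya`.
  have hlawa : μ.map (fun ω i => Ya i ω) = Measure.infinitePi fun _ : ℕ => Pa := by
    rw [hYa_indep.map_fun_eq_infinitePi_map hYa]; simp_rw [hYa_law]
  have hlawb : μ.map (fun ω i => Yb i ω) = Measure.infinitePi fun _ : ℕ => Pb := by
    rw [hYb_indep.map_fun_eq_infinitePi_map hYb]; simp_rw [hYb_law]
  have key := WeaklyConvergesTo.sub_smul_of_indepFun
    (A := fun k x => toEllInf (empiricalProcess Pa F (na k) x))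
    (B := fun k x => toEllInf (empiricalProcess Pb F (nb k) x))
    (measurable_pi_lambda _ hYa) (measurable_pi_lambda _ hYb) hYab hGa hGb hind hlam (hsub lam)
    hνat hνbt (by rw [hlawa]; exact fun h => (hνaw h).comp hna)
    (by rw [hlawb]; exact fun h => (hνbw h).comp hnb)
  refine fun h => (key h).congr' (hnb0.mono fun k hk => ?_)
  congr 1
  ext ω
  congr 1
  dsimp only
  rw [differenceProcess_eq hk, toEllInf_eq (hmem _ _ _ _),
    toEllInf_eq (hFa.memℓp_empiricalProcess _ _), toEllInf_eq (hFb.memℓp_empiricalProcess _ _)]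
  rfl
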